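/- Let $m,n\ge 1$ and $1\le d\le n$ be integers, and let $A(\lambda)=\sum_{j=0}^n A_j\lambda^j$ and $B(\lambda)=\sum_{j=0}^n B_j\lambda^j$ be real $m\times m$ matrix polynomials with $A_n$ and $B_n$ invertible. Put $\ell=n(m+1)$. For a matrix polynomial $P=\sum_{k\le p}P_k\lambda^k$ let $T_{r,c}^{p}(P)$ be the block Toeplitz matrix with $r\times c$ blocks of size $m\times m$ whose $i$-th block row is $(0,\dots,0,P_p,P_{p-1},\dots,P_0,0,\dots,0)$, with $P_p$ in block column $i$. Let $S=S_\ell(A,B)=\begin{pmatrix}T^n_{\ell-n,\ell}(A)\\T^n_{\ell-n,\ell}(B)\end{pmatrix}$ be the extended Sylvester matrix, and $\tau(C)=T^d_{\ell-d,\ell}(C)$ for $\deg C\le d$. A common (right) factor of $A,B$ is a matrix polynomial $C$ with $A=\bar A C$, $B=\bar B C$ for some matrix polynomials $\bar A,\bar B$. The subspace method with input $(A,B,d)$: (1) take $V_0=(V_{md},\dots,V_1)$, a basis of the span of right singular vectors of $S$ for its $md$ smallest singular values (if $\dim\ker S=md$ this is any basis of $\ker S$); (2) cut each $V_i$ into $\ell$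 blocks $v_{i,1},\dots,v_{i,\ell}\in\mathbb R^m$ and form the block Hankel matrix $H(V_i)$ with $(d+1)\times(\ell-d)$ blocks, whose block $(k,j)$ is $v_{i,k+j-1}$, and $\mathcal K=[H(V_{md}),\dots,H(V_1)]$; (3) take orthonormal left singular vectors $u_m,\dots,u_1$ of $\mathcal K$ for its $m$ smallest singular values (zero singular values from the left null space included), and let $P(\lambda)=P_d\lambda^d+\dots+P_0$, $(P_d,\dots,P_0)=(u_m,\dots,u_1)^\top$. If $P_d$ is invertible, the result is the monic polynomial $\hat C=P_d^{-1}P$. Theorem. The method can be run, and every run of it has the following properties. (a) Suppose that $V_0$ is a basis of $\ker S$ and $\mathcal K$ is rank deficient, $\operatorname{rank}\mathcal K<m(d+1)$. Then $u_m,\dots,u_1$ lie in the left null space of $\mathcal K$, and $\tau(P)V_0=0$. The matrix $P_d$ is invertible if and only if $A,B$ have a monic common factor of degree $d$. In that case $\hat C$ is monic of degree $d$ and is an exact common factor of $A$ and $B$; it is a greatest one (for every common factor $D$ of $A,B$ there is a matrix polynomial $Q$ with $\hat C=QD$); and every $F$ of degree at most $d$ with invertible coefficient $F_d$ and $\tau(F)V_0=0$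 is of the form $F=G\hat C$ with a constant invertible matrix $G$. (b) If $SV_0=0$ (where $\ker S$ may have dimension larger than $md$), $\operatorname{rank}\mathcal K\le md$ and $P_d$ is invertible, then $\hat C$ is an exact common factor of $A$ and $B$. (c) If $V_0$ is a basis of $\ker S$ and $A,B$ have a monic common factor of degree $d$, then $\operatorname{rank}\mathcal K=md$; in particular $\mathcal K$ is rank deficient. (d) In every case, and so in particular if $\mathcal K$ is not rank deficient, the method gives an approximate common factor in the following sense. The polynomial $P$ minimizes $\sum_i\|\tau(F)V_i\|^2$ among all $F$ of degree at most $d$ with $\sum_{k=0}^d F_kF_k^\top=I$, and $P$ is itself such an $F$. Among the pairs $(A',B')$ of matrix polynomials of degree at most $n$ that have $P$ as exact common right factor there is one that is closest to $(A,B)$ in the distance $\big(\sum_{j=0}^n\|A_j-A'_j\|_F^2+\sum_{j=0}^n\|B_j-B'_j\|_F^2\big)^{1/2}$. If $P_d$ is invertible, $\hat C$ is monic of degree $d$, and such a closest pair exists for $\hat C$ as well. (e) If $\mathcal K$ is not rank deficient, then $\sum_i\|\tau(P)V_i\|^2>0$, and if moreover $\dim\ker S\le md$, then $A,B$ have no monic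 common factor of degree $d$. -/

import Mathlib

open Polynomial

noncomputable section

/-- Real `m × m` matrix polynomials. -/
abbrev MatPoly (m : ℕ) := Polynomial (Matrix (Fin m) (Fin m) ℝ)

/-- Block Toeplitz band matrix with `r` block rows and `c` block columns; block row `i` is
`(0, …, 0, P_p, P_{p-1}, …, P_0, 0, …, 0)`, with `P_p` in block column `i`. -/
def bandToeplitz {m : ℕ} (r c p : ℕ) (P : MatPoly m) :
    Matrix (Fin r × Fin m) (Fin c × Fin m) ℝ :=
  Matrix.of fun i j =>
    if i.1.val ≤ j.1.val ∧ j.1.val ≤ i.1.val + p then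
      P.coeff (p - (j.1.val - i.1.val)) i.2 j.2
    else 0

/-- The extended Sylvester resultant `S_ℓ(A, B)` of two matrix polynomials of degree `n`:
`ℓ - n` shifted block rows of coefficients of `A` above `ℓ - n` block rows of `B`. -/
def sylvesterResultant {m : ℕ} (l n : ℕ) (A B : MatPoly m) :
    Matrix ((Fin (l - n) × Fin m) ⊕ (Fin (l - n) × Fin m)) (Fin l × Fin m) ℝ :=
  Matrix.fromRows (bandToeplitz (l - n) l n A) (bandToeplitz (l - n) l n B)

/-- The block Toeplitz matrix `τ(C)` of a matrix polynomial of degree at most `d`, acting on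
vectors with `ℓ` blocks. -/
def tau {m : ℕ} (l d : ℕ) (C : MatPoly m) :
    Matrix (Fin (l - d) × Fin m) (Fin l × Fin m) ℝ :=
  bandToeplitz (l - d) l d C

/-- The stacked block Hankel matrix `[H(V_i)]_i`, where `V_i` (the columns of `V`) is cut into
`ℓ` blocks of length `m`, and `H(V_i)` has `d + 1` block rows:
block `(k, j)` of `H(V_i)` is block `k + j` of `V_i`. -/
def stackedHankel {m l s : ℕ} (d : ℕ) (V : Matrix (Fin l × Fin m) (Fin s) ℝ) :
    Matrix (Fin (d + 1) × Fin m) (Fin s × Fin (l - d)) ℝ :=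
  Matrix.of fun r c =>
    V (⟨r.1.val + c.2.val, by have := r.1.isLt; have := c.2.isLt; omega⟩, r.2) c.1

/-- The columns of `W` are orthonormal right singular vectors of `M` that belong to its `k`
smallest singular values (`x ↦ M x` on the whole space, so that the kernel counts with singular
value zero). -/
def IsSmallestRightSingular {ρ κ : Type*} [Fintype ρ] [Fintype κ] [DecidableEq κ] {k : ℕ}
    (M : Matrix ρ κ ℝ) (W : Matrix κ (Fin k) ℝ) : Prop :=
  W.transpose * W = 1 ∧
  ∃ σ : Fin k → ℝ, (∀ i, 0 ≤ σ i) ∧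
    M.transpose * M * W = W * Matrix.diagonal (fun i => σ i ^ 2) ∧
    ∀ x : κ → ℝ, W.transpose.mulVec x = 0 →
      ∀ i, σ i ^ 2 * (x ⬝ᵥ x) ≤ M.mulVec x ⬝ᵥ M.mulVec x

/-- The columns of `V` are a basis of the (numerical) null space of `M` of dimension `k`, the span
of the right singular vectors for the `k` smallest singular values. If `M` has a kernel of
dimension `k`, these `V` are exactly the bases of the kernel. -/
def IsNullBasis {ρ κ : Type*} [Fintype ρ] [Fintype κ] [DecidableEq κ] {k : ℕ}
    (M : Matrix ρ κ ℝ) (V : Matrix κ (Fin k) ℝ) : Prop :=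
  ∃ (W : Matrix κ (Fin k) ℝ) (T : Matrix (Fin k) (Fin k) ℝ),
    IsSmallestRightSingular M W ∧ IsUnit T ∧ V = W * T

/-- A run of the subspace method on `(A, B, d)`: the `m d` columns of `V` are a basis of the
(numerical) null space of `S_{n(m+1)}(A, B)`, and the `m` columns of `U` are left singular vectors,
for the `m` smallest singular values, of the stacked block Hankel matrix built from `V`. -/
structure IsSubspaceRun {m : ℕ} (n d : ℕ) (A B : MatPoly m)
    (V : Matrix (Fin (n * (m + 1)) × Fin m) (Fin (m * d)) ℝ)
    (U : Matrix (Fin (d + 1) × Fin m) (Fin m) ℝ) : Prop where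
  nullBasis : IsNullBasis (sylvesterResultant (n * (m + 1)) n A B) V
  leftSingular : IsSmallestRightSingular (stackedHankel d V).transpose U

/-- The matrix polynomial `C_d λ^d + ⋯ + C_0` with `(C_d, …, C_0) = Uᵀ`. -/
def rawFactor {m d : ℕ} (U : Matrix (Fin (d + 1) × Fin m) (Fin m) ℝ) : MatPoly m :=
  ∑ k : Fin (d + 1), monomial (d - k.val) (Matrix.of fun a b => U (k, b) a)

/-- Normalization `C_d⁻¹ C(λ)` to a monic polynomial (meaningful if `C_d` is invertible). -/
def monicFactor {m : ℕ} (d : ℕ) (P : MatPoly m) : MatPoly m :=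
  Polynomial.C (P.coeff d)⁻¹ * P

/-- `F` is an exact common right factor of `A` and `B`. -/
def IsCommonRightFactor {m : ℕ} (A B F : MatPoly m) : Prop :=
  (∃ A' : MatPoly m, A = A' * F) ∧ (∃ B' : MatPoly m, B = B' * F)

/-- Square of the Frobenius norm. -/
def frobSq {ρ κ : Type*} [Fintype ρ] [Fintype κ] (M : Matrix ρ κ ℝ) : ℝ :=
  ∑ i, ∑ j, M i j ^ 2

/-- Distance of two pairs of matrix polynomials of degree at most `n`. -/
def pairDist {m : ℕ} (n : ℕ) (A B A' B' : MatPoly m) : ℝ :=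
  Real.sqrt (∑ j ∈ Finset.range (n + 1), frobSq (A.coeff j - A'.coeff j) +
    ∑ j ∈ Finset.range (n + 1), frobSq (B.coeff j - B'.coeff j))

/-- `(A', B')` is the least squares perturbation of `(A, B)` with `F` as exact common right factor:
a closest pair of degree at most `n` to `(A, B)` among those that have the right factor `F`. -/
def IsClosestPair {m : ℕ} (n : ℕ) (A B F A' B' : MatPoly m) : Prop :=
  A'.natDegree ≤ n ∧ B'.natDegree ≤ n ∧ IsCommonRightFactor A' B' F ∧
  ∀ A'' B'' : MatPoly m, A''.natDegree ≤ n → B''.natDegree ≤ n →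
    IsCommonRightFactor A'' B'' F → pairDist n A B A' B' ≤ pairDist n A B A'' B''

/-- The coefficient rows `(C_d, …, C_0)` of `P` are orthonormal, and `P` has degree at most `d`. -/
def HasOrthonormalCoeffs {m : ℕ} (d : ℕ) (P : MatPoly m) : Prop :=
  P.natDegree ≤ d ∧
    ∑ k ∈ Finset.range (d + 1), P.coeff k * (P.coeff k).transpose = 1

end

/-! Let matrix polynomials act on sequences of vectors, with `λ` as the left shift. A vector with
`l` blocks is a window of a sequence, written in reversed time, and a band Toeplitz matrix kills it
exactly when the corresponding recurrence holds inside the window. An invertible leading coefficient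
lets every finite solution extend uniquely to an infinite one, so `ker τ(F)` has dimension `m * d`
when `F_d` is invertible.

The size `n * (m + 1)` enters in `sylvesterResultant_mulVec_eq_zero_iff`. If the window of `y` lies
in `ker S`, extend it so that `A y = 0`. Then `B y` vanishes at the first `m * n` times, and it is
annihilated by the central polynomial `det A`, of degree `m * n` with invertible leading
coefficient; hence `B y = 0`. So `ker S` consists of the windows of common solutions, a
shift-invariant space.

Linear algebra passes back to polynomials: an inclusion of kernels makes the rows of one matrix
combinations of those of the other. For band matrices this gives right divisibility, and for `S` a
Bézout identity `F = Q A + R B`, which makes an annihilator of `ker S` a left multiple of every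
common factor.

The products `τ(F) V` and `(F_d, …, F_0) 𝒦` have the same entries. Thus the left null space of `𝒦`
describes the polynomials annihilating `V`. Shift invariance gives `rank 𝒦 ≤ m * d` when `V` spans
`ker S`. If an annihilator with invertible `F_d` exists, all annihilators of degree at most `d` are
`G F` with constant `G`, so the rank is at least `m * d`; orthonormality of the rows of `P = G F`
then makes `G` invertible, and with it `P_d`.

The approximate statements rest on the trace minimality of the smallest singular vectors
(`IsSmallestRightSingular.frobSq_mul_le`) and on orthogonal projection (`exists_closest_multiple`).
-/

/-! ### Matrix polynomials acting on sequences -/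

/-- The action of a matrix polynomial on sequences of vectors, `λ` acting as the left shift. -/
noncomputable def seqAct {m : ℕ} (P : MatPoly m) (y : ℕ → Fin m → ℝ) (t : ℕ) : Fin m → ℝ :=
  P.sum fun j c => c.mulVec (y (t + j))

theorem seqAct_eq_sum {m : ℕ} {P : MatPoly m} {p : ℕ} (hP : P.natDegree ≤ p)
    (y : ℕ → Fin m → ℝ) (t : ℕ) :
    seqAct P y t = ∑ j ∈ Finset.range (p + 1), (P.coeff j).mulVec (y (t + j)) :=
  P.sum_over_range' (f := fun j c => c.mulVec (y (t + j))) (fun _ => Matrix.zero_mulVec _) (p + 1)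
    (by omega)

theorem seqAct_add {m : ℕ} (P Q : MatPoly m) (y : ℕ → Fin m → ℝ) (t : ℕ) :
    seqAct (P + Q) y t = seqAct P y t + seqAct Q y t :=
  Polynomial.sum_add_index P Q _ (fun _ => Matrix.zero_mulVec _) fun _ _ _ => Matrix.add_mulVec _ _ _

theorem seqAct_monomial {m : ℕ} (k : ℕ) (c : Matrix (Fin m) (Fin m) ℝ) (y : ℕ → Fin m → ℝ) (t : ℕ) :
    seqAct (monomial k c) y t = c.mulVec (y (t + k)) :=
  Polynomial.sum_monomial_index c _ (Matrix.zero_mulVec _)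

theorem seqAct_monomial_mul {m : ℕ} (k : ℕ) (c : Matrix (Fin m) (Fin m) ℝ) (P : MatPoly m)
    (y : ℕ → Fin m → ℝ) (t : ℕ) :
    seqAct (monomial k c * P) y t = c.mulVec (seqAct P y (t + k)) := by
  induction P using Polynomial.induction_on' with
  | add P Q hP hQ => rw [mul_add, seqAct_add, hP, hQ, seqAct_add, Matrix.mulVec_add]
  | monomial j b =>
    rw [monomial_mul_monomial, seqAct_monomial, seqAct_monomial, Matrix.mulVec_mulVec, add_assoc]

/-- This makes sequences a left module, so solutions for a right factor are solutions for every left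
multiple. -/
theorem seqAct_mul {m : ℕ} (Q P : MatPoly m) (y : ℕ → Fin m → ℝ) :
    seqAct (Q * P) y = seqAct Q (seqAct P y) := by
  funext t
  induction Q using Polynomial.induction_on' with
  | add Q R hQ hR => rw [add_mul, seqAct_add, hQ, hR, seqAct_add]
  | monomial j b => rw [seqAct_monomial_mul, seqAct_monomial]

theorem seqAct_zero_right {m : ℕ} (P : MatPoly m) : seqAct P 0 = 0 := by
  funext t
  rw [seqAct_eq_sum le_rfl]
  simp

theorem seqAct_shift {m : ℕ} (P : MatPoly m) (y : ℕ → Fin m → ℝ) (s t : ℕ) :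
    seqAct P (fun i => y (s + i)) t = seqAct P y (s + t) := by
  rw [seqAct_eq_sum le_rfl, seqAct_eq_sum le_rfl]
  simp only [add_assoc]

/-- A matrix polynomial is determined by its action. -/
theorem eq_of_seqAct_eq {m : ℕ} {P Q : MatPoly m} (h : ∀ y, seqAct P y 0 = seqAct Q y 0) :
    P = Q := by
  have key : ∀ (R : MatPoly m) (k : ℕ) (b : Fin m) (a : Fin m),
      -- The test sequence is the unit vector `e_b` placed at time `k`; it reads off column `b` of
      -- the coefficient of `λ^k`.
      seqAct R (fun i => if i = k then Pi.single b 1 else 0) 0 a = R.coeff k a b := by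
    intro R k b a
    rw [seqAct_eq_sum (p := R.natDegree + k) (by omega)]
    simp only [zero_add, Finset.sum_apply]
    rw [Finset.sum_eq_single k]
    · simp
    · intro j _ hj
      simp [hj]
    · intro hk
      simp at hk
  ext k a b
  rw [← key P, ← key Q, h]

/-! ### Band Toeplitz matrices on windows of sequences -/

/-- The vector with blocks `y_{l-1}, …, y_1, y_0`. -/
def window {m : ℕ} (l : ℕ) (y : ℕ → Fin m → ℝ) : Fin l × Fin m → ℝ :=
  fun q => y (l - 1 - q.1) q.2

theorem exists_window_eq {m l : ℕ} (x : Fin l × Fin m → ℝ) : ∃ y, window l y = x := by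
  refine ⟨fun t a => if h : t < l then x (⟨l - 1 - t, by omega⟩, a) else 0, ?_⟩
  funext ⟨i, a⟩
  have := i.isLt
  simp only [window]
  rw [dif_pos (by omega)]
  congr 2
  ext
  simp only
  omega

theorem window_eq_iff {m l : ℕ} {y z : ℕ → Fin m → ℝ} :
    window l y = window l z ↔ ∀ t < l, y t = z t := by
  constructor
  · intro h t ht
    funext a
    have := congrFun h (⟨l - 1 - t, by omega⟩, a)
    simp only [window] at this
    rwa [show l - 1 - (l - 1 - t) = t by omega] at this
  · intro h
    funext ⟨i, a⟩
    have := i.isLt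
    simp only [window]
    rw [h _ (by omega)]

theorem sum_fin_band {M : Type*} [AddCommMonoid M] {c p i : ℕ} (h : i + p < c) (f : ℕ → M) :
    ∑ j : Fin c, (if i ≤ j.val ∧ j.val ≤ i + p then f j else 0) =
      ∑ k ∈ Finset.range (p + 1), f (i + k) := by
  rw [Fin.sum_univ_eq_sum_range (fun j => if i ≤ j ∧ j ≤ i + p then f j else 0),
    ← Finset.sum_filter, ← Finset.sum_image (s := Finset.range (p + 1)) (g := fun k => i + k)
      (fun a _ b _ hab => by simpa using hab)]
  apply Finset.sum_congr _ fun _ _ => rfl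
  ext j
  simp only [Finset.mem_filter, Finset.mem_range, Finset.mem_image]
  constructor
  · rintro ⟨h1, h2, h3⟩
    exact ⟨j - i, by omega, by omega⟩
  · rintro ⟨k, hk, rfl⟩
    omega

/-- Rows list coefficients from the top degree down and windows list times from the last down, so
block row `i` is the recurrence at time `l - 1 - p - i`. -/
theorem bandToeplitz_mulVec_window {m l p : ℕ} {P : MatPoly m} (hP : P.natDegree ≤ p)
    (y : ℕ → Fin m → ℝ) (i : Fin (l - p)) (a : Fin m) :
    (bandToeplitz (l - p) l p P).mulVec (window l y) (i, a) = seqAct P y (l - 1 - p - i) a := by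
  have hi := i.isLt
  have h1 : (bandToeplitz (l - p) l p P).mulVec (window l y) (i, a) =
      ∑ j : Fin l, (if i.val ≤ j.val ∧ j.val ≤ i.val + p then
        (P.coeff (p - (j - i))).mulVec (y (l - 1 - j)) a else 0) := by
    simp only [Matrix.mulVec, dotProduct, bandToeplitz, Matrix.of_apply, window,
      Fintype.sum_prod_type]
    refine Finset.sum_congr rfl fun j _ => ?_
    split_ifs <;> simp
  rw [h1, sum_fin_band (by omega) fun j => (P.coeff (p - (j - i))).mulVec (y (l - 1 - j)) a,
    seqAct_eq_sum hP, Finset.sum_apply, ← Finset.sum_range_reflect]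
  refine Finset.sum_congr rfl fun k hk => ?_
  rw [Finset.mem_range] at hk
  congr 3 <;> omega

theorem bandToeplitz_mulVec_window_eq_zero {m l p : ℕ} {P : MatPoly m} (hP : P.natDegree ≤ p)
    (y : ℕ → Fin m → ℝ) :
    (bandToeplitz (l - p) l p P).mulVec (window l y) = 0 ↔ ∀ t < l - p, seqAct P y t = 0 := by
  constructor
  · intro h t ht
    funext a
    have := congrFun h (⟨l - 1 - p - t, by omega⟩, a)
    rw [bandToeplitz_mulVec_window hP] at this
    simp only at this
    rwa [show l - 1 - p - (l - 1 - p - t) = t by omega] at this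
  · intro h
    funext ⟨i, a⟩
    have := i.isLt
    rw [bandToeplitz_mulVec_window hP, h _ (by omega)]
    rfl

/-! ### Recurrences with invertible leading coefficient -/

/-- If the leading coefficient is invertible, solutions are determined by initial values. -/
theorem eq_of_seqAct_of_init {m p : ℕ} {P : MatPoly m} (hP : P.natDegree ≤ p)
    (hu : IsUnit (P.coeff p)) {y z : ℕ → Fin m → ℝ} {l : ℕ}
    (hact : ∀ t < l - p, seqAct P y t = seqAct P z t) (h0 : ∀ t < p, y t = z t) :
    ∀ t < l, y t = z t := by
  intro t
  induction t using Nat.strong_induction_on with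
  | _ t ih =>
    intro htl
    by_cases htp : t < p
    · exact h0 t htp
    have h := hact (t - p) (by omega)
    rw [seqAct_eq_sum hP, seqAct_eq_sum hP, Finset.sum_range_succ, Finset.sum_range_succ,
      Finset.sum_congr rfl fun j hj => ?_, add_left_cancel_iff,
      show t - p + p = t by omega] at h
    · exact Matrix.mulVec_injective_of_isUnit hu h
    · rw [Finset.mem_range] at hj
      rw [ih (t - p + j) (by omega) (by omega)]

theorem eq_zero_of_seqAct_of_init {m p : ℕ} {P : MatPoly m} (hP : P.natDegree ≤ p)
    (hu : IsUnit (P.coeff p)) {y : ℕ → Fin m → ℝ} (hact : seqAct P y = 0)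
    (h0 : ∀ t < p, y t = 0) : y = 0 := by
  funext t
  exact eq_of_seqAct_of_init hP hu (z := 0) (l := t + 1)
    (fun s _ => by rw [hact, seqAct_zero_right]) h0 t (by omega)

/-- The solution of the recurrence `P y = 0` with initial values `g`. -/
noncomputable def recurSeq {m : ℕ} (P : MatPoly m) (p : ℕ) (g : ℕ → Fin m → ℝ) : ℕ → Fin m → ℝ
  | t => if _h : t < p then g t else
      -(P.coeff p)⁻¹.mulVec (∑ j : Fin p, (P.coeff j).mulVec (recurSeq P p g (t - p + j)))
termination_by t => t
decreasing_by have := j.isLt; omega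

theorem recurSeq_init {m p : ℕ} (P : MatPoly m) (g : ℕ → Fin m → ℝ) {t : ℕ} (h : t < p) :
    recurSeq P p g t = g t := by
  rw [recurSeq, dif_pos h]

theorem seqAct_recurSeq {m p : ℕ} {P : MatPoly m} (hP : P.natDegree ≤ p)
    (hu : IsUnit (P.coeff p)) (g : ℕ → Fin m → ℝ) : seqAct P (recurSeq P p g) = 0 := by
  funext t
  rw [seqAct_eq_sum hP, Finset.sum_range_succ, recurSeq.eq_1 P p g (t + p), dif_neg (by omega),
    Matrix.mulVec_neg, Matrix.mulVec_mulVec,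
    Matrix.mul_nonsing_inv _ ((Matrix.isUnit_iff_isUnit_det _).1 hu), Matrix.one_mulVec,
    Nat.add_sub_cancel,
    Fin.sum_univ_eq_sum_range (fun j => (P.coeff j).mulVec (recurSeq P p g (t + j)))]
  simp

/-- Finite solutions extend to infinite ones. -/
theorem bandToeplitz_mulVec_eq_zero_iff {m l p : ℕ} {P : MatPoly m} (hP : P.natDegree ≤ p)
    (hu : IsUnit (P.coeff p)) (x : Fin l × Fin m → ℝ) :
    (bandToeplitz (l - p) l p P).mulVec x = 0 ↔ ∃ y, window l y = x ∧ seqAct P y = 0 := by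
  constructor
  · intro h
    obtain ⟨y, rfl⟩ := exists_window_eq x
    rw [bandToeplitz_mulVec_window_eq_zero hP] at h
    refine ⟨recurSeq P p y, ?_, seqAct_recurSeq hP hu y⟩
    rw [window_eq_iff]
    refine eq_of_seqAct_of_init hP hu (fun t ht => ?_) fun t ht => recurSeq_init P y ht
    rw [h t ht, seqAct_recurSeq hP hu]
    rfl
  · rintro ⟨y, rfl, h⟩
    rw [bandToeplitz_mulVec_window_eq_zero hP]
    intro t _
    rw [h]
    rfl

/-! ### The determinant and the kernel of the Sylvester matrix -/

/-- A matrix polynomial of degree `n` with invertible leading coefficient has a central left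
multiple of degree `m n` with invertible leading coefficient, its determinant. -/
theorem exists_central_mul {m n : ℕ} {A : MatPoly m} (hA : A.natDegree ≤ n)
    (hu : IsUnit (A.coeff n)) :
    ∃ R : MatPoly m, (R * A).natDegree ≤ m * n ∧ IsUnit ((R * A).coeff (m * n)) ∧
      ∀ B : MatPoly m, B * (R * A) = R * A * B := by
  set a : Matrix (Fin m) (Fin m) ℝ[X] := matPolyEquiv.symm A with ha
  have haA : matPolyEquiv a = A := matPolyEquiv.apply_symm_apply A
  have hcoeff : ∀ i j k, (a i j).coeff k = A.coeff k i j := fun i j k => by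
    rw [← matPolyEquiv_coeff_apply, haA]
  have hdeg : ∀ i j, (a i j).natDegree ≤ n := fun i j => by
    rw [natDegree_le_iff_coeff_eq_zero]
    intro k hk
    rw [hcoeff, coeff_eq_zero_of_natDegree_lt (by omega)]
    rfl
  have hdet : matPolyEquiv a.adjugate * A = a.det.map (algebraMap ℝ _) := by
    conv_lhs => rw [← haA]
    rw [← map_mul, Matrix.adjugate_mul, matPolyEquiv_smul_one]
  have hdetdeg : a.det.natDegree ≤ m * n := by
    rw [Matrix.det_apply]
    refine natDegree_sum_le_of_forall_le _ _ fun σ _ => ?_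
    refine (natDegree_smul_le _ _).trans ((natDegree_prod_le _ _).trans ?_)
    refine (Finset.sum_le_sum fun i _ => hdeg (σ i) i).trans ?_
    simp
  -- In degree `m * n` each product in the Leibniz formula contributes only the degree `n`
  -- coefficients of its factors.
  have hlead : a.det.coeff (m * n) = (A.coeff n).det := by
    rw [Matrix.det_apply, Matrix.det_apply, finsetSum_coeff]
    refine Finset.sum_congr rfl fun σ _ => ?_
    have := coeff_prod_of_natDegree_le Finset.univ (fun i => a (σ i) i) n fun i _ => hdeg (σ i) i
    rw [Finset.card_univ, Fintype.card_fin] at this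
    rw [coeff_smul, this]
    simp only [hcoeff]
  refine ⟨matPolyEquiv a.adjugate, ?_, ?_, fun B => ?_⟩
  · rw [hdet]
    exact natDegree_map_le.trans hdetdeg
  · rw [hdet, coeff_map, hlead]
    exact ((Matrix.isUnit_iff_isUnit_det _).1 hu).map _
  · rw [hdet, ← matPolyEquiv_smul_one, ← matPolyEquiv.apply_symm_apply B, ← map_mul, ← map_mul]
    simp

/-- The kernel of the Sylvester matrix consists of the windows of common infinite solutions. -/
theorem sylvesterResultant_mulVec_eq_zero_iff {m n : ℕ} {A B : MatPoly m} (hA : A.natDegree ≤ n)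
    (hB : B.natDegree ≤ n) (hAn : IsUnit (A.coeff n)) (x : Fin (n * (m + 1)) × Fin m → ℝ) :
    (sylvesterResultant (n * (m + 1)) n A B).mulVec x = 0 ↔
      ∃ y, window (n * (m + 1)) y = x ∧ seqAct A y = 0 ∧ seqAct B y = 0 := by
  have hsplit : (sylvesterResultant (n * (m + 1)) n A B).mulVec x = 0 ↔
      (bandToeplitz (n * (m + 1) - n) (n * (m + 1)) n A).mulVec x = 0 ∧
      (bandToeplitz (n * (m + 1) - n) (n * (m + 1)) n B).mulVec x = 0 := by
    rw [sylvesterResultant, Matrix.fromRows_mulVec]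
    constructor
    · intro h
      exact ⟨funext fun i => congrFun h (Sum.inl i), funext fun i => congrFun h (Sum.inr i)⟩
    · rintro ⟨h1, h2⟩
      rw [h1, h2]
      exact Sum.elim_zero_zero
  rw [hsplit, bandToeplitz_mulVec_eq_zero_iff hA hAn]
  constructor
  · rintro ⟨⟨y, rfl, hy⟩, h2⟩
    refine ⟨y, rfl, hy, ?_⟩
    rw [bandToeplitz_mulVec_window_eq_zero hB] at h2
    -- Centrality gives `(R A)(B y) = B (R (A y)) = 0`. The `n * (m + 1) - n = m * n` block rows of
    -- `B` supply exactly the zero initial values this recurrence needs.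
    obtain ⟨R, hdeg, hu, hcomm⟩ := exists_central_mul hA hAn
    refine eq_zero_of_seqAct_of_init hdeg hu ?_ fun t ht => h2 t ?_
    · rw [← seqAct_mul, ← hcomm, seqAct_mul, seqAct_mul, hy, seqAct_zero_right, seqAct_zero_right]
    · rw [mul_add, mul_one, Nat.add_sub_cancel, mul_comm]
      exact ht
  · rintro ⟨y, rfl, h1, h2⟩
    refine ⟨⟨y, rfl, h1⟩, ?_⟩
    rw [bandToeplitz_mulVec_window_eq_zero hB]
    intro t _
    rw [h2]
    rfl

/-! ### From kernel inclusions to divisibility -/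

/-- Over a field, `ker M ≤ ker N` makes the rows of `N` combinations of those of `M`. -/
theorem exists_eq_mul_of_ker_le {ρ ρ' κ : Type*} [Fintype ρ] [Fintype κ] [DecidableEq ρ]
    [DecidableEq κ] {M : Matrix ρ κ ℝ} {N : Matrix ρ' κ ℝ}
    (h : ∀ x, M.mulVec x = 0 → N.mulVec x = 0) : ∃ X : Matrix ρ' ρ ℝ, N = X * M := by
  -- With `s` a section of `M` onto its range, `N ∘ s` extended to the whole space is the required
  -- `X`: the difference `x - s (M x)` lies in `ker M`, hence in `ker N`.
  obtain ⟨s, hs⟩ := M.mulVecLin.rangeRestrict.exists_rightInverse_of_surjective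
    (LinearMap.range_rangeRestrict _)
  obtain ⟨g, hg⟩ := (N.mulVecLin ∘ₗ s).exists_extend
  refine ⟨LinearMap.toMatrix' g, Matrix.toLin'.injective (LinearMap.ext fun x => ?_)⟩
  rw [Matrix.toLin'_mul, Matrix.toLin'_toMatrix']
  have h1 : g (M.mulVecLin x) = N.mulVecLin (s (M.mulVecLin.rangeRestrict x)) :=
    LinearMap.congr_fun hg (M.mulVecLin.rangeRestrict x)
  have h2 : M.mulVec (s (M.mulVecLin.rangeRestrict x)) = M.mulVec x :=
    congrArg Subtype.val (LinearMap.congr_fun hs (M.mulVecLin.rangeRestrict x))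
  have h3 := h (x - s (M.mulVecLin.rangeRestrict x)) (by rw [Matrix.mulVec_sub, h2, sub_self])
  rw [Matrix.mulVec_sub, sub_eq_zero] at h3
  exact h3.trans h1.symm

/-- Block row `i` represents `λ^(l - 1 - p - i) P`, so the blocks of `Y` are the coefficients of the
left multiplier `Q`. -/
theorem exists_mul_of_rows {m l p : ℕ} {P : MatPoly m} (hP : P.natDegree ≤ p)
    (Y : Matrix (Fin m) (Fin (l - p) × Fin m) ℝ) :
    ∃ Q : MatPoly m, ∀ y, seqAct (Q * P) y 0 =
      (Y * bandToeplitz (l - p) l p P).mulVec (window l y) := by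
  refine ⟨∑ i : Fin (l - p), monomial (l - 1 - p - i) (Matrix.of fun a b => Y a (i, b)),
    fun y => ?_⟩
  have hsum : ∀ (s : Finset (Fin (l - p))) (f : Fin (l - p) → MatPoly m) z,
      seqAct (∑ i ∈ s, f i) z 0 = ∑ i ∈ s, seqAct (f i) z 0 := by
    intro s f z
    induction s using Finset.cons_induction with
    | empty => simp [seqAct]
    | cons i s hi ih => rw [Finset.sum_cons, Finset.sum_cons, seqAct_add, ih]
  rw [seqAct_mul, hsum, ← Matrix.mulVec_mulVec]
  funext a
  simp only [seqAct_monomial, zero_add, Finset.sum_apply]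
  rw [Matrix.mulVec, dotProduct, Fintype.sum_prod_type]
  refine Finset.sum_congr rfl fun i _ => ?_
  simp only [bandToeplitz_mulVec_window hP]
  rfl

theorem seqAct_zero_eq_row {m l p : ℕ} {P : MatPoly m} (hP : P.natDegree ≤ p) (hpl : p < l)
    (y : ℕ → Fin m → ℝ) :
    seqAct P y 0 = ((bandToeplitz (l - p) l p P).submatrix
      (fun a => ((⟨l - 1 - p, by omega⟩ : Fin (l - p)), a)) id).mulVec (window l y) := by
  funext a
  have := bandToeplitz_mulVec_window (l := l) hP y ⟨l - 1 - p, by omega⟩ a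
  simp only [Nat.sub_self] at this
  rw [← this]
  rfl

/-- Inclusion of kernels of banded Toeplitz matrices gives divisibility. -/
theorem exists_mul_of_ker_bandToeplitz_le {m l p q : ℕ} {P F : MatPoly m} (hP : P.natDegree ≤ p)
    (hF : F.natDegree ≤ q) (hql : q < l)
    (h : ∀ x, (bandToeplitz (l - p) l p P).mulVec x = 0 →
      (bandToeplitz (l - q) l q F).mulVec x = 0) :
    ∃ Q : MatPoly m, F = Q * P := by
  obtain ⟨X, hX⟩ := exists_eq_mul_of_ker_le h
  obtain ⟨Q, hQ⟩ := exists_mul_of_rows hP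
    (X.submatrix (fun a => ((⟨l - 1 - q, by omega⟩ : Fin (l - q)), a)) id)
  refine ⟨Q, eq_of_seqAct_eq fun y => ?_⟩
  rw [hQ, seqAct_zero_eq_row hF hql, hX]
  rfl

/-- A polynomial annihilating the kernel of the Sylvester matrix is a combination of `A`, `B`. -/
theorem exists_bezout_of_ker_sylvesterResultant_le {m l n q : ℕ} {A B F : MatPoly m}
    (hA : A.natDegree ≤ n) (hB : B.natDegree ≤ n) (hF : F.natDegree ≤ q) (hql : q < l)
    (h : ∀ x, (sylvesterResultant l n A B).mulVec x = 0 →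
      (bandToeplitz (l - q) l q F).mulVec x = 0) :
    ∃ Q R : MatPoly m, F = Q * A + R * B := by
  obtain ⟨X, hX⟩ := exists_eq_mul_of_ker_le h
  set Y := X.submatrix (fun a => ((⟨l - 1 - q, by omega⟩ : Fin (l - q)), a)) id with hY
  obtain ⟨Q, hQ⟩ := exists_mul_of_rows (l := l) hA Y.toCols₁
  obtain ⟨R, hR⟩ := exists_mul_of_rows (l := l) hB Y.toCols₂
  refine ⟨Q, R, eq_of_seqAct_eq fun y => ?_⟩
  rw [seqAct_add, hQ, hR, seqAct_zero_eq_row hF hql, ← Matrix.add_mulVec,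
    ← Matrix.fromCols_mul_fromRows, Matrix.fromCols_toCols, hX]
  rfl

/-! ### Singular vectors for the smallest singular values -/

theorem col_mul {ρ κ ι : Type*} [Fintype κ] (M : Matrix ρ κ ℝ) (X : Matrix κ ι ℝ) (w : ι) :
    (M * X).col w = M.mulVec (X.col w) := rfl

theorem exists_smallest_injection {κ : Type*} [Fintype κ] (lam : κ → ℝ) {k : ℕ} (hk : k ≤ Fintype.card κ) :
    ∃ e : Fin k → κ, Function.Injective e ∧ ∀ i, ∀ j ∉ Set.range e, lam (e i) ≤ lam j := by
  set g := Fintype.equivFin κ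
  set s := Tuple.sort (lam ∘ g.symm) with hs
  have hmono : Monotone ((lam ∘ g.symm) ∘ s) := Tuple.monotone_sort _
  refine ⟨fun i => g.symm (s (Fin.castLE hk i)),
    g.symm.injective.comp (s.injective.comp (Fin.castLE_injective hk)), fun i j hj => ?_⟩
  obtain ⟨t, rfl⟩ := g.symm.surjective j
  obtain ⟨u, rfl⟩ := s.surjective t
  refine hmono (le_of_not_gt fun hlt => hj ?_)
  have hlt' : u.val < i.val := hlt
  exact ⟨⟨u.val, by omega⟩, rfl⟩

section SingularVectors

variable {ρ κ : Type*} [Fintype ρ] [Fintype κ]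

theorem frobSq_eq_sum_dotProduct {k : ℕ} (X : Matrix ρ (Fin k) ℝ) :
    frobSq X = ∑ w, X.col w ⬝ᵥ X.col w := by
  rw [frobSq, Finset.sum_comm]
  simp [dotProduct, sq]

theorem frobSq_eq_zero_iff (X : Matrix ρ κ ℝ) : frobSq X = 0 ↔ X = 0 := by
  constructor
  · intro h
    ext i j
    have h1 := (Finset.sum_eq_zero_iff_of_nonneg fun i _ =>
      Finset.sum_nonneg fun j _ => sq_nonneg (X i j)).1 h i (Finset.mem_univ i)
    have h2 := (Finset.sum_eq_zero_iff_of_nonneg fun j _ => sq_nonneg (X i j)).1 h1 j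
      (Finset.mem_univ j)
    simpa using h2
  · rintro rfl
    simp [frobSq]

theorem frobSq_nonneg (X : Matrix ρ κ ℝ) : 0 ≤ frobSq X :=
  Finset.sum_nonneg fun _ _ => Finset.sum_nonneg fun _ _ => sq_nonneg _

theorem frobSq_transpose (X : Matrix ρ κ ℝ) : frobSq X.transpose = frobSq X := by
  rw [frobSq, Finset.sum_comm]
  rfl

theorem dotProduct_self_nonneg_real (x : κ → ℝ) : 0 ≤ x ⬝ᵥ x :=
  Finset.sum_nonneg fun _ _ => mul_self_nonneg _

/-- Pythagoras for the projection onto the span of orthonormal columns. -/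
theorem dotProduct_self_eq_add_of_orthonormal {k : ℕ} {X : Matrix κ (Fin k) ℝ}
    (hX : X.transpose * X = 1) (x : κ → ℝ) :
    x ⬝ᵥ x = X.transpose.mulVec x ⬝ᵥ X.transpose.mulVec x +
      (x - X.mulVec (X.transpose.mulVec x)) ⬝ᵥ (x - X.mulVec (X.transpose.mulVec x)) := by
  have h1 : X.mulVec (X.transpose.mulVec x) ⬝ᵥ X.mulVec (X.transpose.mulVec x) =
      X.transpose.mulVec x ⬝ᵥ X.transpose.mulVec x := by
    rw [Matrix.dotProduct_mulVec, ← Matrix.mulVec_transpose, Matrix.mulVec_mulVec, hX,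
      Matrix.one_mulVec]
  have h2 : x ⬝ᵥ X.mulVec (X.transpose.mulVec x) =
      X.transpose.mulVec x ⬝ᵥ X.transpose.mulVec x := by
    rw [Matrix.dotProduct_mulVec, ← Matrix.mulVec_transpose]
  rw [sub_dotProduct, dotProduct_sub, dotProduct_sub, h1,
    dotProduct_comm (X.mulVec _) x, h2]
  ring

theorem transpose_mulVec_sub_proj {k : ℕ} {X : Matrix κ (Fin k) ℝ}
    (hX : X.transpose * X = 1) (x : κ → ℝ) :
    X.transpose.mulVec (x - X.mulVec (X.transpose.mulVec x)) = 0 := by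
  rw [Matrix.mulVec_sub, Matrix.mulVec_mulVec, hX, Matrix.one_mulVec, sub_self]

theorem dotProduct_mulVec_self_eq (M : Matrix ρ κ ℝ) (x y : κ → ℝ) :
    M.mulVec x ⬝ᵥ M.mulVec y = (M.transpose * M).mulVec x ⬝ᵥ y := by
  rw [Matrix.dotProduct_mulVec, ← Matrix.mulVec_transpose, Matrix.mulVec_mulVec]

/-- Splitting of `‖M x‖²` along an invariant subspace of `Mᵀ M`. -/
theorem dotProduct_mulVec_self_split {k : ℕ} {M : Matrix ρ κ ℝ} {W : Matrix κ (Fin k) ℝ}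
    (hW : W.transpose * W = 1) {c : Fin k → ℝ}
    (hM : M.transpose * M * W = W * Matrix.diagonal c) (x : κ → ℝ) :
    M.mulVec x ⬝ᵥ M.mulVec x = ∑ i, c i * W.transpose.mulVec x i ^ 2 +
      M.mulVec (x - W.mulVec (W.transpose.mulVec x)) ⬝ᵥ
        M.mulVec (x - W.mulVec (W.transpose.mulVec x)) := by
  set a := W.transpose.mulVec x with ha
  set z := x - W.mulVec a with hz
  have hWz : W.transpose.mulVec z = 0 := transpose_mulVec_sub_proj hW x
  have hx : x = W.mulVec a + z := by rw [hz]; abel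
  have hc : ∀ y, M.mulVec (W.mulVec a) ⬝ᵥ M.mulVec y =
      (Matrix.diagonal c).mulVec a ⬝ᵥ W.transpose.mulVec y := by
    intro y
    rw [dotProduct_mulVec_self_eq, Matrix.mulVec_mulVec, hM, ← Matrix.mulVec_mulVec,
      Matrix.dotProduct_mulVec, Matrix.vecMul_transpose]
  have h1 : M.mulVec (W.mulVec a) ⬝ᵥ M.mulVec z = 0 := by
    rw [hc, hWz, dotProduct_zero]
  have h2 : M.mulVec (W.mulVec a) ⬝ᵥ M.mulVec (W.mulVec a) =
      ∑ i, c i * a i ^ 2 := by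
    rw [hc, Matrix.mulVec_mulVec (M := W.transpose), hW, Matrix.one_mulVec]
    refine Finset.sum_congr rfl fun i _ => ?_
    rw [Matrix.mulVec_diagonal]
    ring
  conv_lhs => rw [hx]
  rw [Matrix.mulVec_add, add_dotProduct, dotProduct_add, dotProduct_add, h1, h2,
    dotProduct_comm (M.mulVec z), h1]
  ring

variable [DecidableEq κ]

/-- The trace of `Mᵀ M` on orthonormal frames is smallest for the smallest singular vectors. -/
theorem IsSmallestRightSingular.frobSq_mul_le {k : ℕ} {M : Matrix ρ κ ℝ} {W X : Matrix κ (Fin k) ℝ}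
    (h : IsSmallestRightSingular M W) (hX : X.transpose * X = 1) :
    frobSq (M * W) ≤ frobSq (M * X) := by
  obtain ⟨hW, σ, hσ, hM, hmin⟩ := h
  rcases Nat.eq_zero_or_pos k with rfl | hk
  · simp [frobSq]
  have : Nonempty (Fin k) := ⟨⟨0, hk⟩⟩
  obtain ⟨i₀, hi₀⟩ := Finite.exists_max fun i => σ i ^ 2
  have hWcol : ∀ w, W.transpose.mulVec (W.col w) = Pi.single w 1 := by
    intro w
    rw [← col_mul, hW]
    ext i
    simp [Matrix.one_apply, Pi.single_apply]
  have hleft : frobSq (M * W) = ∑ i, σ i ^ 2 := by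
    rw [frobSq_eq_sum_dotProduct]
    refine Finset.sum_congr rfl fun w _ => ?_
    rw [col_mul, dotProduct_mulVec_self_split hW hM, hWcol]
    simp [Pi.single_apply]
  -- The largest selected value `σ i₀` bounds `‖M x‖²` from below on the complement of `W`. Taking
  -- it as baseline makes the weights `σ i ^ 2 - σ i₀ ^ 2` nonpositive, so the Bessel bound below
  -- can be inserted in the right direction.
  have hcol : ∀ x : κ → ℝ, ∑ i, (σ i ^ 2 - σ i₀ ^ 2) * W.transpose.mulVec x i ^ 2 +
      σ i₀ ^ 2 * (x ⬝ᵥ x) ≤ M.mulVec x ⬝ᵥ M.mulVec x := by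
    intro x
    rw [dotProduct_mulVec_self_split hW hM, dotProduct_self_eq_add_of_orthonormal hW x]
    have := hmin _ (transpose_mulVec_sub_proj hW x) i₀
    have h2 : ∑ i, (σ i ^ 2 - σ i₀ ^ 2) * W.transpose.mulVec x i ^ 2 +
        σ i₀ ^ 2 * (W.transpose.mulVec x ⬝ᵥ W.transpose.mulVec x) =
        ∑ i, σ i ^ 2 * W.transpose.mulVec x i ^ 2 := by
      rw [dotProduct, Finset.mul_sum, ← Finset.sum_add_distrib]
      exact Finset.sum_congr rfl fun i _ => by ring
    linarith
  have hbessel : ∀ i, ∑ w, W.transpose.mulVec (X.col w) i ^ 2 ≤ 1 := by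
    intro i
    have h1 := dotProduct_self_eq_add_of_orthonormal hX (W.col i)
    have h2 : W.col i ⬝ᵥ W.col i = 1 := by
      have := congrFun (hWcol i) i
      rwa [Pi.single_eq_same] at this
    have h3 := dotProduct_self_nonneg_real (W.col i - X.mulVec (X.transpose.mulVec (W.col i)))
    have h4 : X.transpose.mulVec (W.col i) ⬝ᵥ X.transpose.mulVec (W.col i) =
        ∑ w, W.transpose.mulVec (X.col w) i ^ 2 := by
      refine Finset.sum_congr rfl fun w _ => ?_
      rw [← sq]
      congr 1
      exact dotProduct_comm _ _
    linarith
  have hXcol : ∀ w, X.col w ⬝ᵥ X.col w = 1 := by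
    intro w
    have := congrFun (congrFun hX w) w
    rwa [Matrix.one_apply_eq] at this
  calc frobSq (M * W) = ∑ i, (σ i ^ 2 - σ i₀ ^ 2) * 1 + ∑ _w : Fin k, σ i₀ ^ 2 := by
        rw [hleft, ← Finset.sum_add_distrib]
        exact Finset.sum_congr rfl fun i _ => by ring
    _ ≤ ∑ i, (σ i ^ 2 - σ i₀ ^ 2) * ∑ w, W.transpose.mulVec (X.col w) i ^ 2 +
          ∑ _w : Fin k, σ i₀ ^ 2 := by
        gcongr ?_ + _
        exact Finset.sum_le_sum fun i _ =>
          mul_le_mul_of_nonpos_left (hbessel i) (sub_nonpos.2 (hi₀ i))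
    _ = ∑ w, (∑ i, (σ i ^ 2 - σ i₀ ^ 2) * W.transpose.mulVec (X.col w) i ^ 2 +
          σ i₀ ^ 2 * (X.col w ⬝ᵥ X.col w)) := by
        simp only [Finset.mul_sum, hXcol, mul_one]
        rw [Finset.sum_comm, ← Finset.sum_add_distrib]
    _ ≤ frobSq (M * X) := by
        rw [frobSq_eq_sum_dotProduct]
        exact Finset.sum_le_sum fun w _ => hcol _

/-- If the kernel is large enough, the smallest singular vectors lie in it. -/
theorem IsSmallestRightSingular.mul_eq_zero {k : ℕ} {M : Matrix ρ κ ℝ} {W : Matrix κ (Fin k) ℝ}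
    (h : IsSmallestRightSingular M W) (hk : k ≤ Module.finrank ℝ (LinearMap.ker M.mulVecLin)) :
    M * W = 0 := by
  obtain ⟨hW, σ, hσ, hM, hmin⟩ := h
  have hzero : ∀ i, σ i ^ 2 = 0 := by
    intro i
    by_contra hi
    have hpos : 0 < σ i ^ 2 := lt_of_le_of_ne (sq_nonneg _) (Ne.symm hi)
    set f : LinearMap.ker M.mulVecLin →ₗ[ℝ] Fin k → ℝ :=
      W.transpose.mulVecLin ∘ₗ Submodule.subtype _ with hf
    have hker : ∀ x : LinearMap.ker M.mulVecLin, M.mulVec x.1 = 0 := fun x => x.2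
    -- A kernel vector orthogonal to `W` satisfies `σ i ^ 2 * ‖x‖² ≤ 0`, so it vanishes. As the
    -- kernel has dimension at least `k`, coordinates along `W` then identify it with `Fin k → ℝ`.
    have hinj : Function.Injective f := by
      rw [← LinearMap.ker_eq_bot, LinearMap.ker_eq_bot']
      intro x hx
      have h1 := hmin x.1 hx i
      rw [hker, dotProduct_zero] at h1
      have h2 := dotProduct_self_nonneg_real x.1
      have h3 : x.1 ⬝ᵥ x.1 = 0 := by nlinarith
      exact Subtype.ext (dotProduct_self_eq_zero.1 h3)
    have hsurj : Function.Surjective f := by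
      refine (LinearMap.injective_iff_surjective_of_finrank_eq_finrank ?_).1 hinj
      refine le_antisymm (LinearMap.finrank_le_finrank_of_injective hinj) ?_
      simpa using hk
    -- A kernel vector with `W`-coordinates `e_i` makes the split of `‖M x‖² = 0` contain the term
    -- `σ i ^ 2`, a contradiction.
    obtain ⟨x, hx⟩ := hsurj (Pi.single i 1)
    have hx' : W.transpose.mulVec x.1 = Pi.single i 1 := hx
    have h1 := dotProduct_mulVec_self_split hW hM x.1
    rw [hker, dotProduct_zero, hx'] at h1
    have h2 := dotProduct_self_nonneg_real (M.mulVec (x.1 - W.mulVec (Pi.single i 1)))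
    have h3 : ∑ j, σ j ^ 2 * (Pi.single i (1 : ℝ) : Fin k → ℝ) j ^ 2 = σ i ^ 2 := by
      simp [Pi.single_apply]
    linarith
  have h0 : M.transpose * (M * W) = 0 := by
    rw [← Matrix.mul_assoc, hM]
    simp [hzero]
  have h1 : (M * W).transpose * (M * W) = 0 := by
    rw [Matrix.transpose_mul, Matrix.mul_assoc, h0, Matrix.mul_zero]
  rw [← frobSq_eq_zero_iff, frobSq_eq_sum_dotProduct]
  exact Finset.sum_eq_zero fun w _ => congrFun (congrFun h1 w) w

/-- Diagonalize `Mᵀ M` orthogonally and keep the eigenvectors of its `k` smallest eigenvalues; a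
vector orthogonal to them has only coordinates with larger or equal eigenvalues. -/
theorem exists_isSmallestRightSingular (M : Matrix ρ κ ℝ) {k : ℕ} (hk : k ≤ Fintype.card κ) :
    ∃ W : Matrix κ (Fin k) ℝ, IsSmallestRightSingular M W := by
  have hpos : (M.transpose * M).PosSemidef := by
    have := Matrix.posSemidef_conjTranspose_mul_self M
    rwa [Matrix.conjTranspose_eq_transpose_of_trivial] at this
  have hN := hpos.isHermitian
  set lam := hN.eigenvalues with hlam
  obtain ⟨e, he, hmin⟩ := exists_smallest_injection lam hk
  set Q : Matrix κ κ ℝ := Matrix.of fun q j => (hN.eigenvectorBasis j).ofLp q with hQ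
  have hQQ : Q.transpose * Q = 1 := by
    ext i j
    have := orthonormal_iff_ite.1 hN.eigenvectorBasis.orthonormal j i
    rw [EuclideanSpace.inner_eq_star_dotProduct] at this
    rw [Matrix.one_apply]
    simp only [eq_comm (a := i)]
    exact this
  have hQQ' : Q * Q.transpose = 1 := mul_eq_one_comm.1 hQQ
  have hNQ : M.transpose * M * Q = Q * Matrix.diagonal lam := by
    ext q j
    rw [Matrix.mul_diagonal, mul_comm]
    exact congrFun (hN.mulVec_eigenvectorBasis j) q
  have hlam0 : ∀ j, 0 ≤ lam j := hpos.eigenvalues_nonneg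
  refine ⟨Q.submatrix id e, ?_, fun i => √(lam (e i)), fun i => Real.sqrt_nonneg _, ?_, ?_⟩
  · have := congrArg (fun X => X.submatrix e e) hQQ
    simp only [Matrix.submatrix_one _ he] at this
    exact this
  · ext q i
    simp only [Real.sq_sqrt (hlam0 _)]
    have := congrFun (congrFun hNQ q) (e i)
    rw [Matrix.mul_diagonal] at this ⊢
    exact this
  · intro x hx i
    simp only [Real.sq_sqrt (hlam0 _)]
    set z := Q.transpose.mulVec x with hz
    have hxz : x = Q.mulVec z := by rw [hz, Matrix.mulVec_mulVec, hQQ', Matrix.one_mulVec]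
    have h1 : x ⬝ᵥ x = ∑ j, z j * z j := by
      conv_lhs => rw [hxz, Matrix.dotProduct_mulVec, ← Matrix.mulVec_transpose,
        Matrix.mulVec_mulVec, hQQ, Matrix.one_mulVec]
      rfl
    have h2 : M.mulVec x ⬝ᵥ M.mulVec x = ∑ j, lam j * (z j * z j) := by
      rw [dotProduct_mulVec_self_eq]
      conv_lhs => rw [hxz, Matrix.mulVec_mulVec, hNQ, ← Matrix.mulVec_mulVec,
        Matrix.dotProduct_mulVec, ← Matrix.mulVec_transpose, Matrix.mulVec_mulVec, hQQ,
        Matrix.one_mulVec]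
      refine Finset.sum_congr rfl fun j _ => ?_
      rw [Matrix.mulVec_diagonal, mul_assoc]
    rw [h1, h2, Finset.mul_sum]
    refine Finset.sum_le_sum fun j _ => ?_
    by_cases hj : j ∈ Set.range e
    · obtain ⟨i', rfl⟩ := hj
      have : z (e i') = 0 := congrFun hx i'
      simp [this]
    · exact mul_le_mul_of_nonneg_right (hmin i j hj) (mul_self_nonneg _)

end SingularVectors

/-! ### Duality of Toeplitz and Hankel matrices -/

/-- The coefficients `(F_d, …, F_0)ᵀ` stacked as a matrix. -/
def stackedCoeffs {m : ℕ} (d : ℕ) (F : MatPoly m) : Matrix (Fin (d + 1) × Fin m) (Fin m) ℝ :=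
  Matrix.of fun q a => F.coeff (d - q.1) a q.2

theorem natDegree_rawFactor_le {m d : ℕ} (U : Matrix (Fin (d + 1) × Fin m) (Fin m) ℝ) :
    (rawFactor U).natDegree ≤ d :=
  natDegree_sum_le_of_forall_le _ _ fun _ _ => (natDegree_monomial_le _).trans (Nat.sub_le _ _)

theorem stackedCoeffs_rawFactor {m d : ℕ} (U : Matrix (Fin (d + 1) × Fin m) (Fin m) ℝ) :
    stackedCoeffs d (rawFactor U) = U := by
  ext ⟨k, b⟩ a
  have hk := k.isLt
  rw [stackedCoeffs, Matrix.of_apply, rawFactor, finsetSum_coeff, Finset.sum_eq_single k]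
  · simp
  · intro j _ hj
    have hj' := j.isLt
    rw [coeff_monomial, if_neg]
    intro h
    exact hj (Fin.ext (by simp only at h; omega))
  · simp

theorem stackedCoeffs_eq_zero {m d : ℕ} {F : MatPoly m} (hF : F = 0) : stackedCoeffs d F = 0 := by
  subst hF
  rfl

theorem stackedCoeffs_transpose_mul_self {m : ℕ} (d : ℕ) (F : MatPoly m) :
    (stackedCoeffs d F).transpose * stackedCoeffs d F =
      ∑ k ∈ Finset.range (d + 1), F.coeff k * (F.coeff k).transpose := by
  ext a a'
  rw [Matrix.mul_apply, Fintype.sum_prod_type, Matrix.sum_apply, ← Finset.sum_range_reflect,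
    ← Fin.sum_univ_eq_sum_range
      (fun k => (F.coeff (d + 1 - 1 - k) * (F.coeff (d + 1 - 1 - k)).transpose) a a')]
  refine Finset.sum_congr rfl fun k _ => ?_
  rw [Matrix.mul_apply]
  rfl

theorem hasOrthonormalCoeffs_iff {m d : ℕ} {F : MatPoly m} : HasOrthonormalCoeffs d F ↔
    F.natDegree ≤ d ∧ (stackedCoeffs d F).transpose * stackedCoeffs d F = 1 := by
  rw [stackedCoeffs_transpose_mul_self]
  rfl

/-- `τ(F) V` and `(F_d, …, F_0) K` have the same entries. -/
theorem tau_mul_apply {m l d s : ℕ} {F : MatPoly m} (hF : F.natDegree ≤ d)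
    (V : Matrix (Fin l × Fin m) (Fin s) ℝ) (i : Fin (l - d)) (a : Fin m) (j : Fin s) :
    (tau l d F * V) (i, a) j = ((stackedCoeffs d F).transpose * stackedHankel d V) a (j, i) := by
  obtain ⟨y, hy⟩ := exists_window_eq (V.col j)
  have hi := i.isLt
  have hV : ∀ q, V q j = window l y q := fun q => (congrFun hy q).symm
  have h1 : (tau l d F * V) (i, a) j = (tau l d F).mulVec (V.col j) (i, a) := rfl
  rw [h1, ← hy, tau, bandToeplitz_mulVec_window hF, seqAct_eq_sum hF, Finset.sum_apply,
    ← Finset.sum_range_reflect, Matrix.mul_apply, Fintype.sum_prod_type,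
    ← Fin.sum_univ_eq_sum_range (fun k => (F.coeff (d + 1 - 1 - k)).mulVec
      (y (l - 1 - d - i + (d + 1 - 1 - k))) a)]
  refine Finset.sum_congr rfl fun k _ => ?_
  rw [Matrix.mulVec, dotProduct]
  refine Finset.sum_congr rfl fun b _ => ?_
  have hk := k.isLt
  rw [stackedHankel, Matrix.of_apply, hV, window]
  simp only [Matrix.transpose_apply, stackedCoeffs, Matrix.of_apply]
  congr 3
  omega

theorem tau_mul_eq_zero_iff {m l d s : ℕ} {F : MatPoly m} (hF : F.natDegree ≤ d)
    (V : Matrix (Fin l × Fin m) (Fin s) ℝ) :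
    tau l d F * V = 0 ↔ (stackedCoeffs d F).transpose * stackedHankel d V = 0 := by
  constructor
  · intro h
    ext a ⟨j, i⟩
    rw [← tau_mul_apply hF, h]
    rfl
  · intro h
    ext ⟨i, a⟩ j
    rw [tau_mul_apply hF, h]
    rfl

theorem frobSq_tau_mul {m l d s : ℕ} {F : MatPoly m} (hF : F.natDegree ≤ d)
    (V : Matrix (Fin l × Fin m) (Fin s) ℝ) :
    frobSq (tau l d F * V) = frobSq ((stackedHankel d V).transpose * stackedCoeffs d F) := by
  rw [← frobSq_transpose ((stackedHankel d V).transpose * _), Matrix.transpose_mul,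
    Matrix.transpose_transpose]
  simp only [frobSq, Fintype.sum_prod_type, tau_mul_apply hF]
  rw [Finset.sum_comm]
  exact Finset.sum_congr rfl fun a _ => Finset.sum_comm

/-! ### Dimensions of kernels and ranges -/

theorem finrank_ker_mulVecLin {ρ κ : Type*} [Fintype ρ] [Fintype κ] (M : Matrix ρ κ ℝ) :
    M.rank + Module.finrank ℝ (LinearMap.ker M.mulVecLin) = Fintype.card κ := by
  classical
  have := LinearMap.finrank_range_add_finrank_ker M.mulVecLin
  rwa [Module.finrank_pi] at this

/-- A solution is determined by its `d` initial blocks, which the window stores last; this bounds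
the dimension above. Counting the rows of `τ(F)` bounds it below. -/
theorem finrank_ker_tau {m l d : ℕ} {F : MatPoly m} (hF : F.natDegree ≤ d)
    (hu : IsUnit (F.coeff d)) (hdl : d ≤ l) :
    Module.finrank ℝ (LinearMap.ker (tau l d F).mulVecLin) = m * d := by
  apply le_antisymm
  · set f : LinearMap.ker (tau l d F).mulVecLin →ₗ[ℝ] (Fin d × Fin m → ℝ) :=
      LinearMap.funLeft ℝ ℝ (fun q : Fin d × Fin m => ((⟨l - 1 - q.1, by omega⟩ : Fin l), q.2)) ∘ₗ
        Submodule.subtype _ with hf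
    have hinj : Function.Injective f := by
      rw [← LinearMap.ker_eq_bot, LinearMap.ker_eq_bot']
      rintro ⟨x, hx⟩ hfx
      have hx' : (bandToeplitz (l - d) l d F).mulVec x = 0 := hx
      obtain ⟨y, rfl, hy⟩ := (bandToeplitz_mulVec_eq_zero_iff hF hu x).1 hx'
      have hy0 : y = 0 := by
        refine eq_zero_of_seqAct_of_init hF hu hy fun t ht => ?_
        funext b
        have h1 : window l y (⟨l - 1 - t, by omega⟩, b) = 0 := congrFun hfx (⟨t, ht⟩, b)
        rw [window] at h1
        simp only at h1
        rwa [show l - 1 - (l - 1 - t) = t by omega] at h1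
      subst hy0
      rfl
    refine (LinearMap.finrank_le_finrank_of_injective hinj).trans ?_
    rw [Module.finrank_pi, Fintype.card_prod, Fintype.card_fin, Fintype.card_fin, mul_comm]
  · have h1 := finrank_ker_mulVecLin (tau l d F)
    have h2 := (tau l d F).rank_le_card_height
    rw [Fintype.card_prod, Fintype.card_fin, Fintype.card_fin] at h1 h2
    have h3 : (l - d) * m + m * d = l * m := by
      rw [mul_comm m d, ← add_mul, Nat.sub_add_cancel hdl]
    omega

theorem finrank_range_of_mulVec_injective {ρ κ : Type*} [Fintype κ] {V : Matrix ρ κ ℝ}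
    (hV : Function.Injective V.mulVec) :
    Module.finrank ℝ (LinearMap.range V.mulVecLin) = Fintype.card κ := by
  classical
  rw [LinearMap.finrank_range_of_inj (f := V.mulVecLin) hV, Module.finrank_pi]

theorem range_le_ker_of_mul_eq_zero {ρ κ ι : Type*} [Fintype κ] [Fintype ι] {M : Matrix ρ κ ℝ}
    {V : Matrix κ ι ℝ} (h : M * V = 0) :
    LinearMap.range V.mulVecLin ≤ LinearMap.ker M.mulVecLin := by
  rintro _ ⟨c, rfl⟩
  rw [LinearMap.mem_ker, Matrix.mulVecLin_apply, Matrix.mulVecLin_apply, Matrix.mulVec_mulVec, h,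
    Matrix.zero_mulVec]

theorem mul_eq_zero_of_range_le_ker {ρ κ ι : Type*} [Fintype κ] [Fintype ι] {M : Matrix ρ κ ℝ}
    {V : Matrix κ ι ℝ} (h : LinearMap.range V.mulVecLin ≤ LinearMap.ker M.mulVecLin) :
    M * V = 0 := by
  classical
  apply Matrix.toLin'.injective
  ext1 c
  ext1
  rw [Matrix.toLin'_mul, map_zero]
  exact h ⟨_, rfl⟩

theorem IsNullBasis.mulVec_injective {ρ κ : Type*} [Fintype ρ] [Fintype κ] [DecidableEq κ] {k : ℕ}
    {M : Matrix ρ κ ℝ} {V : Matrix κ (Fin k) ℝ} (h : IsNullBasis M V) :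
    Function.Injective V.mulVec := by
  obtain ⟨W, T, hW, hT, rfl⟩ := h
  have h1 : Function.Injective (W.transpose * (W * T)).mulVec := by
    rw [← Matrix.mul_assoc, hW.1, Matrix.one_mul]
    exact Matrix.mulVec_injective_of_isUnit hT
  intro x y hxy
  apply h1
  rw [← Matrix.mulVec_mulVec, hxy, Matrix.mulVec_mulVec]

/-! ### Annihilators of the null space and the rank of the Hankel matrix -/

section Runs

variable {m l d : ℕ} {V : Matrix (Fin l × Fin m) (Fin (m * d)) ℝ}

theorem ker_tau_eq_range (hV : Function.Injective V.mulVec) (hdl : d ≤ l) {F : MatPoly m}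
    (hF : F.natDegree ≤ d) (hu : IsUnit (F.coeff d)) (h : tau l d F * V = 0) :
    LinearMap.range V.mulVecLin = LinearMap.ker (tau l d F).mulVecLin := by
  apply Submodule.eq_of_le_of_finrank_le (range_le_ker_of_mul_eq_zero h)
  rw [finrank_range_of_mulVec_injective hV, finrank_ker_tau hF hu hdl, Fintype.card_fin]

/-- Polynomials of degree at most `d` annihilating the null space are constant multiples of a
regular one. -/
theorem eq_C_mul_of_tau_mul_eq_zero (hV : Function.Injective V.mulVec) (hdl : d < l)
    {P F : MatPoly m} (hP : P.natDegree ≤ d) (hu : IsUnit (P.coeff d)) (hPV : tau l d P * V = 0)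
    (hF : F.natDegree ≤ d) (hFV : tau l d F * V = 0) :
    ∃ G : Matrix (Fin m) (Fin m) ℝ, F = C G * P := by
  have hker := ker_tau_eq_range hV hdl.le hP hu hPV
  obtain ⟨Q, hQ⟩ := exists_mul_of_ker_bandToeplitz_le hP hF hdl fun x hx => by
    have h1 : x ∈ LinearMap.range V.mulVecLin := by
      rw [hker]
      exact hx
    exact range_le_ker_of_mul_eq_zero hFV h1
  have hQ0 : Q.natDegree = 0 := by
    by_contra h0
    have h1 := coeff_mul_add_eq_of_natDegree_le (le_refl Q.natDegree) hP
    rw [← hQ, coeff_eq_zero_of_natDegree_lt (by omega)] at h1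
    have h2 : Q.coeff Q.natDegree = 0 := hu.mul_left_eq_zero.1 h1.symm
    rw [coeff_natDegree, leadingCoeff_eq_zero] at h2
    rw [h2] at h0
    exact h0 natDegree_zero
  exact ⟨Q.coeff 0, by rw [hQ, ← eq_C_of_natDegree_eq_zero hQ0]⟩

/-- A left null vector is a coefficient row of an annihilator `G F`, so it is determined by its
leading block, which determines `G`. The left null space thus has dimension at most `m`. -/
theorem stackedHankel_rank_ge (hm : 0 < m) (hV : Function.Injective V.mulVec) (hdl : d < l)
    {F : MatPoly m} (hF : F.natDegree ≤ d) (hu : IsUnit (F.coeff d)) (hFV : tau l d F * V = 0) :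
    m * d ≤ (stackedHankel d V).rank := by
  have hker := finrank_ker_mulVecLin (stackedHankel d V).transpose
  rw [Matrix.rank_transpose, Fintype.card_prod, Fintype.card_fin, Fintype.card_fin] at hker
  set f : LinearMap.ker (stackedHankel d V).transpose.mulVecLin →ₗ[ℝ] (Fin m → ℝ) :=
      LinearMap.funLeft ℝ ℝ (fun b : Fin m => ((0 : Fin (d + 1)), b)) ∘ₗ
        Submodule.subtype _ with hf
  have hinj : Function.Injective f := by
    rw [← LinearMap.ker_eq_bot, LinearMap.ker_eq_bot']
    rintro ⟨w, hw⟩ hfw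
    have hw' : (stackedHankel d V).transpose.mulVec w = 0 := hw
    -- Repeating the single row `w` in all `m` rows turns it into a matrix polynomial.
    set U : Matrix (Fin (d + 1) × Fin m) (Fin m) ℝ := Matrix.of fun q _ => w q with hU
    have h1 : tau l d (rawFactor U) * V = 0 := by
      rw [tau_mul_eq_zero_iff (natDegree_rawFactor_le U), stackedCoeffs_rawFactor]
      ext a c
      have := congrFun hw' c
      rw [Matrix.mulVec, dotProduct_comm] at this
      exact this
    obtain ⟨G, hG⟩ := eq_C_mul_of_tau_mul_eq_zero hV hdl hF hu hFV (natDegree_rawFactor_le U) h1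
    have h2 : (rawFactor U).coeff d = 0 := by
      ext a b
      have h3 := congrFun (congrFun (stackedCoeffs_rawFactor U) (0, b)) a
      have h4 : w (0, b) = 0 := congrFun hfw b
      simpa [stackedCoeffs, hU, h4] using h3
    have hG0 : G = 0 := by
      rw [hG, coeff_C_mul] at h2
      exact hu.mul_left_eq_zero.1 h2
    have hU0 : U = 0 := by
      rw [← stackedCoeffs_rawFactor U]
      apply stackedCoeffs_eq_zero
      rw [hG, hG0, C_0, zero_mul]
    apply Subtype.ext
    funext q
    exact congrFun (congrFun hU0 q) ⟨0, hm⟩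
  have h1 := LinearMap.finrank_le_finrank_of_injective hinj
  rw [Module.finrank_pi, Fintype.card_fin] at h1
  have h2 : (d + 1) * m = m * d + m := by ring
  omega

theorem transpose_mul_stackedHankel_eq_zero {U : Matrix (Fin (d + 1) × Fin m) (Fin m) ℝ}
    (hU : IsSmallestRightSingular (stackedHankel d V).transpose U)
    (hrank : (stackedHankel d V).rank ≤ m * d) : U.transpose * stackedHankel d V = 0 := by
  have hker := finrank_ker_mulVecLin (stackedHankel d V).transpose
  rw [Matrix.rank_transpose, Fintype.card_prod, Fintype.card_fin, Fintype.card_fin] at hker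
  have h2 : (d + 1) * m = m * d + m := by ring
  have h := congrArg Matrix.transpose (hU.mul_eq_zero (by omega))
  rwa [Matrix.transpose_mul, Matrix.transpose_transpose, Matrix.transpose_zero] at h

end Runs

/-- The Hankel matrix built from a basis of a space of windows of common solutions has rank at most
the dimension of that space. -/
theorem stackedHankel_rank_le {m l d s : ℕ} (hdl : d < l) {A B : MatPoly m}
    {V : Matrix (Fin l × Fin m) (Fin s) ℝ}
    (hV : ∀ x, x ∈ LinearMap.range V.mulVecLin ↔
      ∃ y, window l y = x ∧ seqAct A y = 0 ∧ seqAct B y = 0) :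
    (stackedHankel d V).rank ≤ s := by
  -- The last block column holds the values at times `d, …, 0`. Shifting a common solution by `l - 1
  -- - d - i` brings the values of block column `i` there, so these `s` columns span all others.
  set last : Fin (l - d) := ⟨l - 1 - d, by omega⟩ with hlast
  set K₀ := (stackedHankel d V).submatrix id (fun j : Fin s => (j, last)) with hK₀
  have hcol : ∀ c, ∃ z : Fin s → ℝ, K₀.mulVec z = (stackedHankel d V).col c := by
    rintro ⟨j, i⟩
    have hi := i.isLt
    obtain ⟨y, hy, hyA, hyB⟩ := (hV (V.col j)).1 ⟨Pi.single j 1, by simp⟩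
    have hshift : window l (fun t => y (l - 1 - d - i + t)) ∈ LinearMap.range V.mulVecLin := by
      refine (hV _).2 ⟨_, rfl, ?_, ?_⟩
      · funext t
        rw [seqAct_shift, hyA]
        rfl
      · funext t
        rw [seqAct_shift, hyB]
        rfl
    obtain ⟨z, hz⟩ := hshift
    refine ⟨z, funext fun ⟨k, b⟩ => ?_⟩
    have hk := k.isLt
    have h1 := congrFun hz (⟨k + (l - 1 - d), by omega⟩, b)
    have h2 := congrFun hy (⟨k + i, by omega⟩, b)
    have h3 : K₀.mulVec z (k, b) = V.mulVecLin z (⟨k + (l - 1 - d), by omega⟩, b) := rfl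
    have h4 : (stackedHankel d V).col (j, i) (k, b) = V.col j (⟨k + i, by omega⟩, b) := rfl
    rw [h3, h4, h1, ← h2, window, window]
    simp only
    congr 2
    omega
  choose Z hZ using hcol
  have hK : stackedHankel d V = K₀ * (Matrix.of fun i c => Z c i) := by
    ext q c
    exact (congrFun (hZ c) q).symm
  rw [hK]
  exact (Matrix.rank_mul_le_left _ _).trans ((Matrix.rank_le_card_width _).trans
    (Fintype.card_fin s).le)

/-! ### Common factors, kernels and normalization -/

theorem ker_tau_le_ker_sylvesterResultant {m n d : ℕ} {A B F : MatPoly m} (hA : A.natDegree ≤ n)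
    (hB : B.natDegree ≤ n) (hAn : IsUnit (A.coeff n)) (hF : F.natDegree ≤ d)
    (hu : IsUnit (F.coeff d)) (h : IsCommonRightFactor A B F) :
    LinearMap.ker (tau (n * (m + 1)) d F).mulVecLin ≤
      LinearMap.ker (sylvesterResultant (n * (m + 1)) n A B).mulVecLin := by
  intro x hx
  obtain ⟨y, rfl, hy⟩ := (bandToeplitz_mulVec_eq_zero_iff hF hu x).1 hx
  obtain ⟨⟨A', rfl⟩, ⟨B', rfl⟩⟩ := h
  refine (sylvesterResultant_mulVec_eq_zero_iff hA hB hAn _).2 ⟨y, rfl, ?_, ?_⟩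
  · rw [seqAct_mul, hy, seqAct_zero_right]
  · rw [seqAct_mul, hy, seqAct_zero_right]

theorem isCommonRightFactor_of_ker_tau_le {m l n d : ℕ} {A B F : MatPoly m} (hA : A.natDegree ≤ n)
    (hB : B.natDegree ≤ n) (hnl : n < l) (hF : F.natDegree ≤ d)
    (h : LinearMap.ker (tau l d F).mulVecLin ≤
      LinearMap.ker (sylvesterResultant l n A B).mulVecLin) : IsCommonRightFactor A B F := by
  have hS : ∀ x, (tau l d F).mulVec x = 0 →
      Sum.elim ((bandToeplitz (l - n) l n A).mulVec x) ((bandToeplitz (l - n) l n B).mulVec x) =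
        0 := by
    intro x hx
    rw [← Matrix.fromRows_mulVec]
    exact h hx
  exact ⟨exists_mul_of_ker_bandToeplitz_le hF hA hnl fun x hx =>
      funext fun i => congrFun (hS x hx) (Sum.inl i),
    exists_mul_of_ker_bandToeplitz_le hF hB hnl fun x hx =>
      funext fun i => congrFun (hS x hx) (Sum.inr i)⟩

theorem coeff_monicFactor {m d : ℕ} {P : MatPoly m} (hu : IsUnit (P.coeff d)) :
    (monicFactor d P).coeff d = 1 := by
  rw [monicFactor, coeff_C_mul, Matrix.nonsing_inv_mul _ ((Matrix.isUnit_iff_isUnit_det _).1 hu)]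

theorem natDegree_monicFactor_le {m d : ℕ} {P : MatPoly m} (hP : P.natDegree ≤ d) :
    (monicFactor d P).natDegree ≤ d :=
  (natDegree_C_mul_le _ _).trans hP

theorem C_mul_monicFactor {m d : ℕ} {P : MatPoly m} (hu : IsUnit (P.coeff d)) :
    C (P.coeff d) * monicFactor d P = P := by
  rw [monicFactor, ← mul_assoc, ← C_mul,
    Matrix.mul_nonsing_inv _ ((Matrix.isUnit_iff_isUnit_det _).1 hu), C_1, one_mul]

theorem monicFactor_monic {m d : ℕ} {P : MatPoly m} (hP : P.natDegree ≤ d)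
    (hu : IsUnit (P.coeff d)) : (monicFactor d P).Monic :=
  monic_of_natDegree_le_of_coeff_eq_one d (natDegree_monicFactor_le hP) (coeff_monicFactor hu)

theorem natDegree_monicFactor {m d : ℕ} (hm : 0 < m) {P : MatPoly m} (hP : P.natDegree ≤ d)
    (hu : IsUnit (P.coeff d)) : (monicFactor d P).natDegree = d := by
  have : Nonempty (Fin m) := ⟨⟨0, hm⟩⟩
  refine natDegree_eq_of_le_of_coeff_ne_zero (natDegree_monicFactor_le hP) ?_
  rw [coeff_monicFactor hu]
  exact one_ne_zero

theorem isCommonRightFactor_monicFactor {m d : ℕ} {A B P : MatPoly m} (hu : IsUnit (P.coeff d))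
    (h : IsCommonRightFactor A B P) : IsCommonRightFactor A B (monicFactor d P) := by
  obtain ⟨⟨A', hA⟩, ⟨B', hB⟩⟩ := h
  refine ⟨⟨A' * C (P.coeff d), ?_⟩, ⟨B' * C (P.coeff d), ?_⟩⟩
  · rw [mul_assoc, C_mul_monicFactor hu, hA]
  · rw [mul_assoc, C_mul_monicFactor hu, hB]

/-- The orthonormality relation has the form `G * X = 1`, and a one-sided inverse of a square matrix
suffices. -/
theorem isUnit_of_hasOrthonormalCoeffs_C_mul {m d : ℕ} {G : Matrix (Fin m) (Fin m) ℝ}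
    {F : MatPoly m} (h : HasOrthonormalCoeffs d (C G * F)) : IsUnit G := by
  have h1 := h.2
  simp only [coeff_C_mul, Matrix.mul_assoc] at h1
  rw [← Finset.mul_sum] at h1
  exact IsUnit.of_mul_eq_one _ h1

/-! ### Closest pairs with a prescribed factor -/

/-- Least squares approximation of a matrix polynomial by left multiples of `F`. -/
theorem exists_closest_multiple {m : ℕ} (n : ℕ) (A F : MatPoly m) :
    ∃ A' : MatPoly m, A'.natDegree ≤ n ∧ (∃ Q, A' = Q * F) ∧
      ∀ A'' : MatPoly m, A''.natDegree ≤ n → (∃ Q, A'' = Q * F) →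
        ∑ j ∈ Finset.range (n + 1), frobSq (A.coeff j - A'.coeff j) ≤
          ∑ j ∈ Finset.range (n + 1), frobSq (A.coeff j - A''.coeff j) := by
  set v : MatPoly m → EuclideanSpace ℝ (Fin (n + 1) × Fin m × Fin m) := fun P =>
    WithLp.toLp 2 fun q => P.coeff q.1 q.2.1 q.2.2 with hv
  have hnorm : ∀ P : MatPoly m, ∑ j ∈ Finset.range (n + 1), frobSq (A.coeff j - P.coeff j) =
      ‖v A - v P‖ ^ 2 := by
    intro P
    rw [EuclideanSpace.norm_sq_eq, Fintype.sum_prod_type,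
      ← Fin.sum_univ_eq_sum_range (fun j => frobSq (A.coeff j - P.coeff j))]
    refine Finset.sum_congr rfl fun j _ => ?_
    rw [Fintype.sum_prod_type]
    simp [frobSq, hv]
  -- The left multiples of `F` of degree at most `n` form a subspace of the finite-dimensional
  -- coefficient space, so an orthogonal projection exists for every `F`, even with singular leading
  -- coefficient.
  let S : Submodule ℝ (EuclideanSpace ℝ (Fin (n + 1) × Fin m × Fin m)) :=
    { carrier := {x | ∃ P : MatPoly m, P.natDegree ≤ n ∧ (∃ Q, P = Q * F) ∧ v P = x}
      add_mem' := by
        rintro _ _ ⟨P, hP, ⟨Q, rfl⟩, rfl⟩ ⟨P', hP', ⟨Q', rfl⟩, rfl⟩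
        exact ⟨_, natDegree_add_le_of_degree_le hP hP', ⟨Q + Q', (add_mul _ _ _).symm⟩, by
          ext q
          simp [hv]⟩
      zero_mem' := ⟨0, by simp, ⟨0, (zero_mul _).symm⟩, by
        ext q
        simp [hv]⟩
      smul_mem' := by
        rintro c _ ⟨P, hP, ⟨Q, rfl⟩, rfl⟩
        exact ⟨c • (Q * F), (natDegree_smul_le _ _).trans hP, ⟨c • Q, (smul_mul_assoc _ _ _).symm⟩,
          by
            ext q
            simp [hv]⟩ }
  obtain ⟨A', hA', hQ, hvA'⟩ := S.starProjection_apply_mem (v A)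
  refine ⟨A', hA', hQ, fun A'' hA'' hQ'' => ?_⟩
  rw [hnorm, hnorm, hvA', S.starProjection_minimal]
  refine pow_le_pow_left₀ (Real.iInf_nonneg fun _ => norm_nonneg _) ?_ 2
  exact ciInf_le ⟨0, by rintro _ ⟨x, rfl⟩; exact norm_nonneg _⟩
    (⟨v A'', A'', hA'', hQ'', rfl⟩ : S)

theorem exists_isClosestPair {m : ℕ} (n : ℕ) (A B F : MatPoly m) :
    ∃ A' B' : MatPoly m, IsClosestPair n A B F A' B' := by
  obtain ⟨A', hA', hQA, hminA⟩ := exists_closest_multiple n A F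
  obtain ⟨B', hB', hQB, hminB⟩ := exists_closest_multiple n B F
  exact ⟨A', B', hA', hB', ⟨hQA, hQB⟩, fun A'' B'' hA'' hB'' h =>
    Real.sqrt_le_sqrt (add_le_add (hminA A'' hA'' h.1) (hminB B'' hB'' h.2))⟩

/-! ### Properties of the runs -/

theorem ne_zero_of_transpose_mul_self_eq_one {m d : ℕ} (hm : 0 < m)
    {U : Matrix (Fin (d + 1) × Fin m) (Fin m) ℝ} (hU : U.transpose * U = 1) : U ≠ 0 := by
  have : Nonempty (Fin m) := ⟨⟨0, hm⟩⟩
  rintro rfl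
  rw [Matrix.mul_zero] at hU
  exact zero_ne_one hU

theorem mainTheorem3 (m n d : ℕ) (hm : 0 < m) (hn : 0 < n) (hd1 : 1 ≤ d) (hdn : d ≤ n)
    (A B : MatPoly m)
    (hA : A.natDegree ≤ n) (hB : B.natDegree ≤ n)
    (hAn : IsUnit (A.coeff n)) (hBn : IsUnit (B.coeff n)) :
    -- the method can be run
    (∃ V U, IsSubspaceRun n d A B V U) ∧
    ∀ V U, IsSubspaceRun n d A B V U →
      -- `V` is a basis of the null space, and `K` is rank deficient: exact common factor
      (LinearMap.range V.mulVecLin =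
          LinearMap.ker (sylvesterResultant (n * (m + 1)) n A B).mulVecLin →
        (stackedHankel d V).rank < m * (d + 1) →
        -- the rows of the computed coefficient matrix lie in the left null space of `K`
        U.transpose * stackedHankel d V = 0 ∧
        tau (n * (m + 1)) d (rawFactor U) * V = 0 ∧
        -- the result is monic of degree `d` exactly if there is such a common factor
        (IsUnit ((rawFactor U).coeff d) ↔
          ∃ F : MatPoly m, F.Monic ∧ F.natDegree = d ∧ IsCommonRightFactor A B F) ∧
        (IsUnit ((rawFactor U).coeff d) →
          (monicFactor d (rawFactor U)).Monic ∧
          (monicFactor d (rawFactor U)).natDegree = d ∧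
          IsCommonRightFactor A B (monicFactor d (rawFactor U)) ∧
          -- it is a greatest one
          (∀ D : MatPoly m, IsCommonRightFactor A B D →
            ∃ Q : MatPoly m, monicFactor d (rawFactor U) = Q * D) ∧
          -- uniqueness
          (∀ F : MatPoly m, F.natDegree ≤ d → IsUnit (F.coeff d) →
            tau (n * (m + 1)) d F * V = 0 →
            ∃ G : Matrix (Fin m) (Fin m) ℝ, IsUnit G ∧
              F = Polynomial.C G * monicFactor d (rawFactor U)))) ∧
      -- the null space may have more than `m d` dimensions, if the `m` smallest singular values
      -- of `K` vanish
      (sylvesterResultant (n * (m + 1)) n A B * V = 0 →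
        (stackedHankel d V).rank ≤ m * d →
        IsUnit ((rawFactor U).coeff d) →
          IsCommonRightFactor A B (monicFactor d (rawFactor U))) ∧
      -- an exact common factor makes `K` rank deficient, with left nullity `m`
      (LinearMap.range V.mulVecLin =
          LinearMap.ker (sylvesterResultant (n * (m + 1)) n A B).mulVecLin →
        (∃ F : MatPoly m, F.Monic ∧ F.natDegree = d ∧ IsCommonRightFactor A B F) →
        (stackedHankel d V).rank = m * d) ∧
      -- in every case, and so if `K` is not rank deficient: approximate common factor
      ((HasOrthonormalCoeffs d (rawFactor U) ∧
        ∀ F : MatPoly m, HasOrthonormalCoeffs d F →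
          frobSq (tau (n * (m + 1)) d (rawFactor U) * V) ≤
            frobSq (tau (n * (m + 1)) d F * V)) ∧
       (∃ A' B' : MatPoly m, IsClosestPair n A B (rawFactor U) A' B') ∧
       (IsUnit ((rawFactor U).coeff d) →
          (monicFactor d (rawFactor U)).Monic ∧
          (monicFactor d (rawFactor U)).natDegree = d ∧
          ∃ A' B' : MatPoly m, IsClosestPair n A B (monicFactor d (rawFactor U)) A' B')) ∧
      -- if `K` is not rank deficient, the residual is positive, and a monic common factor of
      -- degree `d` does not exist unless the null space has more than `m d` dimensions
      (¬ (stackedHankel d V).rank < m * (d + 1) →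
        0 < frobSq (tau (n * (m + 1)) d (rawFactor U) * V) ∧
        (Module.finrank ℝ
            (LinearMap.ker (sylvesterResultant (n * (m + 1)) n A B).mulVecLin) ≤ m * d →
          ¬ ∃ F : MatPoly m, F.Monic ∧ F.natDegree = d ∧ IsCommonRightFactor A B F)) := by
  have hnl : n < n * (m + 1) := by nlinarith
  have hdl : d < n * (m + 1) := by omega
  refine ⟨?_, fun V U hrun => ?_⟩
  · obtain ⟨V, hV⟩ := exists_isSmallestRightSingular (k := m * d)
      (sylvesterResultant (n * (m + 1)) n A B) (by
        rw [Fintype.card_prod, Fintype.card_fin, Fintype.card_fin, mul_comm m d]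
        exact Nat.mul_le_mul_right m hdl.le)
    obtain ⟨U, hU⟩ := exists_isSmallestRightSingular (k := m) (stackedHankel d V).transpose (by
        rw [Fintype.card_prod, Fintype.card_fin, Fintype.card_fin]
        exact Nat.le_mul_of_pos_left m (Nat.succ_pos d))
    exact ⟨V, U, ⟨V, 1, hV, isUnit_one, (Matrix.mul_one V).symm⟩, hU⟩
  obtain ⟨hnull, hU⟩ := hrun
  have hinj := hnull.mulVec_injective
  set P := rawFactor U with hP
  have hPdeg : P.natDegree ≤ d := natDegree_rawFactor_le U
  have hPU : stackedCoeffs d P = U := stackedCoeffs_rawFactor U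
  have horth : HasOrthonormalCoeffs d P :=
    hasOrthonormalCoeffs_iff.2 ⟨hPdeg, by rw [hPU]; exact hU.1⟩
  have hPV : (stackedHankel d V).rank ≤ m * d → tau (n * (m + 1)) d P * V = 0 := fun h => by
    rw [tau_mul_eq_zero_iff hPdeg, hPU]
    exact transpose_mul_stackedHankel_eq_zero hU h
  have hexact : sylvesterResultant (n * (m + 1)) n A B * V = 0 →
      (stackedHankel d V).rank ≤ m * d → IsUnit (P.coeff d) →
      IsCommonRightFactor A B (monicFactor d P) := fun hSV hrank hu => by
    refine isCommonRightFactor_monicFactor hu (isCommonRightFactor_of_ker_tau_le hA hB hnl hPdeg ?_)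
    rw [← ker_tau_eq_range hinj hdl.le hPdeg hu (hPV hrank)]
    exact range_le_ker_of_mul_eq_zero hSV
  have hrank_le : LinearMap.range V.mulVecLin =
      LinearMap.ker (sylvesterResultant (n * (m + 1)) n A B).mulVecLin →
      (stackedHankel d V).rank ≤ m * d := fun hV =>
    stackedHankel_rank_le (A := A) (B := B) hdl fun x => by
      rw [hV]
      exact sylvesterResultant_mulVec_eq_zero_iff hA hB hAn x
  have hlead : ∀ F : MatPoly m, F.Monic → F.natDegree = d → IsUnit (F.coeff d) := by
    rintro F hF rfl
    rw [hF.coeff_natDegree]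
    exact isUnit_one
  have htau : ∀ F : MatPoly m, F.Monic → F.natDegree = d → IsCommonRightFactor A B F →
      LinearMap.range V.mulVecLin =
        LinearMap.ker (sylvesterResultant (n * (m + 1)) n A B).mulVecLin →
      tau (n * (m + 1)) d F * V = 0 := fun F hF hFd hAB hV => by
    have hu := hlead F hF hFd
    apply mul_eq_zero_of_range_le_ker
    rw [hV]
    -- The inclusion `ker τ(F) ≤ ker S` is an equality, since both have dimension `m * d`.
    refine (Submodule.eq_of_le_of_finrank_le
      (ker_tau_le_ker_sylvesterResultant hA hB hAn hFd.le hu hAB) ?_).ge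
    rw [← hV, finrank_range_of_mulVec_injective hinj, finrank_ker_tau hFd.le hu hdl.le,
      Fintype.card_fin]
  have hrank_eq : LinearMap.range V.mulVecLin =
      LinearMap.ker (sylvesterResultant (n * (m + 1)) n A B).mulVecLin →
      (∃ F : MatPoly m, F.Monic ∧ F.natDegree = d ∧ IsCommonRightFactor A B F) →
      (stackedHankel d V).rank = m * d := by
    rintro hV ⟨F, hF, hFd, hAB⟩
    exact le_antisymm (hrank_le hV)
      (stackedHankel_rank_ge hm hinj hdl hFd.le (hlead F hF hFd) (htau F hF hFd hAB hV))
  refine ⟨fun hV _ => ?_, hexact, hrank_eq, ⟨⟨horth, fun F hF => ?_⟩, exists_isClosestPair n A B P,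
    fun hu => ⟨monicFactor_monic hPdeg hu, natDegree_monicFactor hm hPdeg hu,
      exists_isClosestPair n A B _⟩⟩, fun hfull => ⟨?_, ?_⟩⟩
  · have hrank := hrank_le hV
    have hSV := mul_eq_zero_of_range_le_ker hV.le
    refine ⟨transpose_mul_stackedHankel_eq_zero hU hrank, hPV hrank, ⟨fun hu => ?_, ?_⟩,
      fun hu => ⟨monicFactor_monic hPdeg hu, natDegree_monicFactor hm hPdeg hu,
        hexact hSV hrank hu, ?_, ?_⟩⟩
    · exact ⟨_, monicFactor_monic hPdeg hu, natDegree_monicFactor hm hPdeg hu, hexact hSV hrank hu⟩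
    · rintro ⟨F, hF, hFd, hAB⟩
      obtain ⟨G, hG⟩ := eq_C_mul_of_tau_mul_eq_zero hinj hdl hFd.le (hlead F hF hFd)
        (htau F hF hFd hAB hV) hPdeg (hPV hrank)
      rw [hG] at horth
      rw [hG, coeff_C_mul]
      exact (isUnit_of_hasOrthonormalCoeffs_C_mul horth).mul (hlead F hF hFd)
    · rintro D ⟨⟨A', hA'⟩, ⟨B', hB'⟩⟩
      obtain ⟨Q, R, hQR⟩ := exists_bezout_of_ker_sylvesterResultant_le hA hB hPdeg hdl fun x hx => by
        have h1 : x ∈ LinearMap.range V.mulVecLin := by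
          rw [hV]
          exact hx
        exact range_le_ker_of_mul_eq_zero (hPV hrank) h1
      refine ⟨C (P.coeff d)⁻¹ * (Q * A' + R * B'), ?_⟩
      rw [monicFactor, mul_assoc, add_mul, mul_assoc Q, mul_assoc R, ← hA', ← hB', ← hQR]
    · intro F hFd hFu hFV
      obtain ⟨G, hG⟩ := eq_C_mul_of_tau_mul_eq_zero hinj hdl hPdeg hu (hPV hrank) hFd hFV
      refine ⟨G * P.coeff d, ?_, ?_⟩
      · rwa [hG, coeff_C_mul] at hFu
      · rw [C_mul, mul_assoc, C_mul_monicFactor hu, hG]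
  · rw [frobSq_tau_mul hPdeg, frobSq_tau_mul hF.1, hPU]
    exact hU.frobSq_mul_le (hasOrthonormalCoeffs_iff.1 hF).2
  · refine lt_of_le_of_ne (frobSq_nonneg _) fun h0 => ?_
    rw [frobSq_tau_mul hPdeg, hPU, eq_comm, frobSq_eq_zero_iff] at h0
    have hker := finrank_ker_mulVecLin (stackedHankel d V).transpose
    rw [Matrix.rank_transpose, Fintype.card_prod, Fintype.card_fin, Fintype.card_fin,
      mul_comm (d + 1) m] at hker
    have hbot : LinearMap.ker (stackedHankel d V).transpose.mulVecLin = ⊥ :=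
      Submodule.finrank_eq_zero.1 (by omega)
    refine ne_zero_of_transpose_mul_self_eq_one hm hU.1 ?_
    ext q a
    have h1 : U.col a ∈ LinearMap.ker (stackedHankel d V).transpose.mulVecLin :=
      funext fun c => congrFun (congrFun h0 c) a
    rw [hbot] at h1
    exact congrFun ((Submodule.mem_bot ℝ).1 h1) q
  · rintro hdim ⟨F, hF, hFd, hAB⟩
    have hu := hlead F hF hFd
    have hle := ker_tau_le_ker_sylvesterResultant hA hB hAn hFd.le hu hAB
    have hge := Submodule.finrank_mono hle
    rw [finrank_ker_tau hFd.le hu hdl.le] at hge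
    -- A common factor makes `ker S` at least `m * d`-dimensional, so the smallest singular vectors
    -- lie in it; with `hdim` they span it, and the rank formula contradicts full rank.
    have hSV : sylvesterResultant (n * (m + 1)) n A B * V = 0 := by
      obtain ⟨W, T, hW, -, rfl⟩ := hnull
      rw [← Matrix.mul_assoc, hW.mul_eq_zero hge, Matrix.zero_mul]
    have hV := Submodule.eq_of_le_of_finrank_le (range_le_ker_of_mul_eq_zero hSV) (by
      rw [finrank_range_of_mulVec_injective hinj, Fintype.card_fin]
      exact hdim)
    apply hfull
    rw [hrank_eq hV ⟨F, hF, hFd, hAB⟩]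
    exact Nat.mul_lt_mul_of_pos_left (Nat.lt_succ_self d) hm
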